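/- Let $p$ be a prime, let $k$ be an algebraically closed field of characteristic $p$, let $G$ be a finite group and let $P\neq 1$ be a $p$-subgroup of $G$. For a subgroup $H$ of a finite group $L$, let $S(L,H)$ be the Scott $kL$-module, i.e. the (up to isomorphism unique) indecomposable direct summand of $\mathrm{Ind}_H^L(k)$ whose socle contains the trivial $kL$-module $k$. For a $kL$-module $M$ put $\ker(M)=\{g\in L\mid gm=m \text{ for all } m\in M\}$, and for a $p$-subgroup $Q$ of $L$ let $M(Q)=M^Q/\sum_{R<Q}M_R^Q$ be the Brauer construction, a $kN_L(Q)$-module, where $M^Q$ is the space of $Q$-fixed points and $M_R^Q=\{\sum_{x\in[Q/R]}xm\mid m\in M^R\}$. A $kL$-module $M$ is called Brauer indecomposable if, for every $p$-subgroup $Q$ of $L$, the restriction of $M(Q)$ to $QC_L(Q)$ is indecomposable or zero. Assume that $P\leq\ker(S(G,P))$ and that $G$ is $p$-nilpotent, i.e. $G=KS$ for some Sylow $p$-subgroup $S$ of $G$ and some normal subgroup $K$ of $G$ of order prime to $p$. If $S(N_G(P),P)$ is Brauer indecomposable, then $S(G,P)$ is Brauer indecomposable. -/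

import Mathlib

/-- `G` is `p`-nilpotent: it has a normal `p`-complement, i.e. a normal `p'`-subgroup `K`
with `G = KS` for a Sylow `p`-subgroup `S` of `G`. -/
def IsPNilpotent (p : ℕ) (G : Type*) [Group G] : Prop :=
  ∃ (K : Subgroup G) (S : Sylow p G),
    K.Normal ∧ (Nat.card K).Coprime p ∧ K ⊔ (S : Subgroup G) = ⊤

namespace Representation

variable {k G V W : Type*} [Field k] [Group G] [AddCommGroup V] [Module k V]
  [AddCommGroup W] [Module k W]

/-- A `kG`-module is indecomposable if it is nonzero and is not the direct sum of two nonzero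
submodules. -/
def IsIndecomposable (ρ : Representation k G V) : Prop :=
  Nontrivial V ∧ ∀ U₁ U₂ : Subrepresentation ρ, IsCompl U₁ U₂ → U₁ = ⊥ ∨ U₂ = ⊥

/-- `ρ` is isomorphic to a direct summand of `σ`. -/
def IsSummandOf (ρ : Representation k G V) (σ : Representation k G W) : Prop :=
  ∃ U₁ U₂ : Subrepresentation σ, IsCompl U₁ U₂ ∧ Nonempty (ρ.Equiv U₁.toRepresentation)

/-- `ρ` is (a representative of the isomorphism class of) the Scott module `S(G, H)`: the
indecomposable direct summand of `Ind_H^G k` whose socle contains the trivial module, that is,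
which has a submodule isomorphic to the trivial module `k`. -/
def IsScottModule (H : Subgroup G) (ρ : Representation k G V) : Prop :=
  ρ.IsIndecomposable ∧ ρ.IsSummandOf (ind H.subtype (trivial k H k)) ∧
    ∃ U : Subrepresentation ρ, Nonempty ((trivial k G k).Equiv U.toRepresentation)

/-- The subspace `M^Q` of `Q`-fixed points. -/
noncomputable def fixedBy (ρ : Representation k G V) (Q : Subgroup G) : Submodule k V :=
  invariants (ρ.comp Q.subtype)

/-- The map `m ↦ ∑ x m`, where `x` runs over coset representatives of `R` in `Q`; it is used
only on `M^R`, where the choice of the representatives is irrelevant. -/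
noncomputable def relTrace (ρ : Representation k G V) (R Q : Subgroup G) : V →ₗ[k] V :=
  ∑ᶠ x : Q ⧸ R.subgroupOf Q, ρ (x.out : Q)

/-- `∑_{R < Q} M_R^Q`, where `M_R^Q` is the image of `M^R` under the relative trace. -/
noncomputable def traceSum (ρ : Representation k G V) (Q : Subgroup G) : Submodule k V :=
  ⨆ (R : Subgroup G) (_ : R < Q), (ρ.fixedBy R).map (ρ.relTrace R Q)

lemma mem_fixedBy {ρ : Representation k G V} {Q : Subgroup G} {v : V} :
    v ∈ ρ.fixedBy Q ↔ ∀ g ∈ Q, ρ g v = v := by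
  simp [fixedBy, mem_invariants]

lemma relTrace_apply [Finite G] (ρ : Representation k G V) (R Q : Subgroup G) (v : V) :
    ρ.relTrace R Q v = ∑ᶠ x : Q ⧸ R.subgroupOf Q, ρ (x.out : Q) v := by
  classical
  have := Fintype.ofFinite (Q ⧸ R.subgroupOf Q)
  rw [relTrace, finsum_eq_sum_of_fintype, finsum_eq_sum_of_fintype, LinearMap.sum_apply]

lemma conj_mem_iff {Q : Subgroup G} {g : G} (hg : g ∈ Subgroup.normalizer (Q : Set G)) (x : G) :
    g * x * g⁻¹ ∈ Q ↔ x ∈ Q :=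
  (Subgroup.mem_normalizer_iff.1 hg x).symm

lemma fixedBy_le_comap (ρ : Representation k G V) (Q : Subgroup G)
    (g : Subgroup.normalizer (Q : Set G)) : ρ.fixedBy Q ≤ (ρ.fixedBy Q).comap (ρ (g : G)) := by
  intro v hv
  rw [Submodule.mem_comap, mem_fixedBy]
  intro x hx
  have h : (g : G)⁻¹ * x * g ∈ Q := by
    rw [← conj_mem_iff g.2]
    simpa [mul_assoc] using hx
  have h2 := mem_fixedBy.1 hv _ h
  calc ρ x (ρ g v) = ρ g (ρ ((g : G)⁻¹ * x * g) v) := by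
        simp only [← Module.End.mul_apply, ← map_mul]
        simp [mul_assoc]
    _ = ρ g v := by rw [h2]

lemma relTrace_conj [Finite G] (ρ : Representation k G V) {R Q : Subgroup G} {g : G}
    (hg : g ∈ Subgroup.normalizer (Q : Set G)) {v : V} (hv : v ∈ ρ.fixedBy R) :
    ρ g (ρ.relTrace R Q v) =
      ρ.relTrace (R.map (MulAut.conj g).toMonoidHom) Q (ρ g v) := by
  have hmem : ∀ y : G, g * y * g⁻¹ ∈ R.map (MulAut.conj g).toMonoidHom ↔ y ∈ R := fun y => by
    simp [Subgroup.mem_map]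
  have hQ : ∀ y : G, g * y * g⁻¹ ∈ Q ↔ y ∈ Q := conj_mem_iff hg
  let c : Q → Q := fun y => ⟨g * y * g⁻¹, (hQ y).2 y.2⟩
  have hc : ∀ x y : Q, (QuotientGroup.mk (c x) :
      Q ⧸ (R.map (MulAut.conj g).toMonoidHom).subgroupOf Q) = QuotientGroup.mk (c y) ↔
      (QuotientGroup.mk x : Q ⧸ R.subgroupOf Q) = QuotientGroup.mk y := fun x y => by
    rw [QuotientGroup.eq, QuotientGroup.eq, Subgroup.mem_subgroupOf, Subgroup.mem_subgroupOf,
      ← hmem]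
    simp [c, mul_assoc]
  rw [relTrace_apply, relTrace_apply, map_finsum _ (Set.toFinite _)]
  refine finsum_eq_of_bijective (fun x => QuotientGroup.mk (c x.out)) ⟨?_, ?_⟩ ?_
  · intro x y hxy
    simpa using (hc _ _).1 hxy
  · intro y
    have hy : g⁻¹ * (y.out : Q) * g ∈ Q := by
      rw [← hQ]; simp [mul_assoc]
    refine ⟨QuotientGroup.mk ⟨_, hy⟩, ?_⟩
    have h1 : c ⟨_, hy⟩ = y.out := Subtype.ext (by simp [c, mul_assoc])
    exact ((hc _ _).2 (QuotientGroup.out_eq' _)).trans (by rw [h1, QuotientGroup.out_eq'])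
  · intro x
    obtain ⟨r, hr⟩ := QuotientGroup.mk_out_eq_mul
      ((R.map (MulAut.conj g).toMonoidHom).subgroupOf Q) (c x.out)
    obtain ⟨s, hs, hsr⟩ := Subgroup.mem_map.1 (Subgroup.mem_subgroupOf.1 r.2)
    have hsr' : ((r : Q) : G) = g * s * g⁻¹ := by simpa using hsr.symm
    rw [hr, Subgroup.coe_mul, hsr']
    calc ρ g (ρ (x.out : Q) v) = ρ g (ρ (x.out : Q) (ρ s v)) := by
          rw [mem_fixedBy.1 hv s hs]
      _ = _ := by
          simp only [← Module.End.mul_apply, ← map_mul]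
          simp [c, mul_assoc]

lemma traceSum_le_comap [Finite G] (ρ : Representation k G V) (Q : Subgroup G)
    (g : Subgroup.normalizer (Q : Set G)) : ρ.traceSum Q ≤ (ρ.traceSum Q).comap (ρ (g : G)) := by
  refine iSup₂_le fun R hR => ?_
  rintro _ ⟨v, hv, rfl⟩
  rw [Submodule.mem_comap, relTrace_conj ρ g.2 hv]
  have hmem : ∀ y : G,
      (g : G) * y * (g : G)⁻¹ ∈ R.map (MulAut.conj (g : G)).toMonoidHom ↔ y ∈ R := fun y => by
    simp [Subgroup.mem_map]
  have hlt : R.map (MulAut.conj (g : G)).toMonoidHom < Q := by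
    refine lt_of_le_not_ge ?_ fun h => hR.not_ge fun y hy =>
      (hmem y).1 (h ((conj_mem_iff g.2 y).2 hy))
    rintro _ ⟨y, hy, rfl⟩
    simpa using (conj_mem_iff g.2 y).2 (hR.le hy)
  refine Submodule.mem_iSup_of_mem _ (Submodule.mem_iSup_of_mem hlt
    (Submodule.mem_map_of_mem ?_))
  rw [mem_fixedBy]
  rintro _ ⟨y, hy, rfl⟩
  calc ρ ((MulAut.conj (g : G)).toMonoidHom y) (ρ g v) = ρ g (ρ y v) := by
        simp only [← Module.End.mul_apply, ← map_mul]
        simp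
    _ = ρ g v := by rw [mem_fixedBy.1 hv y hy]

/-- The action of `N_G(Q)` on `M^Q`. -/
noncomputable def fixedByRep (ρ : Representation k G V) (Q : Subgroup G) :
    Representation k (Subgroup.normalizer (Q : Set G)) (ρ.fixedBy Q) :=
  subrepresentation (ρ.comp (Subgroup.normalizer (Q : Set G)).subtype) (ρ.fixedBy Q)
    (ρ.fixedBy_le_comap Q)

/-- The Brauer construction `M(Q) = M^Q / ∑_{R < Q} M_R^Q`, as a `kN_G(Q)`-module. -/
noncomputable def brauer [Finite G] (ρ : Representation k G V) (Q : Subgroup G) :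
    Representation k (Subgroup.normalizer (Q : Set G))
      (ρ.fixedBy Q ⧸ (ρ.traceSum Q).submoduleOf (ρ.fixedBy Q)) :=
  (ρ.fixedByRep Q).quotient ((ρ.traceSum Q).submoduleOf (ρ.fixedBy Q))
    fun g _ hv => ρ.traceSum_le_comap Q g hv

/-- `M` is Brauer indecomposable: for every `p`-subgroup `Q` of `G`, the restriction of `M(Q)`
to the subgroup `QC_G(Q)` of `N_G(Q)` is indecomposable or zero. -/
def IsBrauerIndecomposable [Finite G] (p : ℕ) (ρ : Representation k G V) : Prop :=
  ∀ Q : Subgroup G, IsPGroup p Q →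
    IsIndecomposable ((ρ.brauer Q).comp
      ((Q ⊔ Subgroup.centralizer (Q : Set G)).subgroupOf
        (Subgroup.normalizer (Q : Set G))).subtype) ∨
    Subsingleton (ρ.fixedBy Q ⧸ (ρ.traceSum Q).submoduleOf (ρ.fixedBy Q))

end Representation

/-! Let `K` be the normal `p`-complement. Averaging over `K` splits a Scott module into `K`-fixed
vectors and a complement, and the trivial submodule makes the first part nonzero, so `K` acts
trivially. The projection of `Ind_P^G k` onto the module therefore factors through the permutation
module `k[G/KP]`. A `p`-group `G/K` permutes that basis transitively, so the fixed vectors form a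
line lying in every nonzero submodule; hence `k[G/KP]` is indecomposable and equals `S(G,P)`
(`IsScottModule.exists_basis`).

When `P` acts trivially, `L = KP` is the kernel, hence normal. For a `p`-subgroup `Q` not inside `L`
no coset is fixed by `Q`, and the Brauer construction vanishes (`subsingleton_brauer_of_permutes`).
For `Q ≤ L` it is the whole module, and it is indecomposable over `QC_G(Q)` as soon as `C_G(Q)L =
G`.

The hypothesis on `N_G(P)`, used only at the subgroup `P`, gives `N_G(P) ≤ C_G(P)L`. The Frattini
argument upgrades this to `G = C_G(P)L`, and conjugating `Q` into `P` inside `L` gives `G = C_G(Q)L`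
(`Subgroup.centralizer_sup_eq_top`). -/

namespace Subrepresentation

variable {k G V : Type*} [Field k] [Group G] [AddCommGroup V] [Module k V]
  {ρ : Representation k G V}

lemma toSubmodule_eq_bot_iff {U : Subrepresentation ρ} : U.toSubmodule = ⊥ ↔ U = ⊥ :=
  ⟨fun h => toSubmodule_injective h, fun h => h ▸ rfl⟩

lemma isCompl_toSubmodule_iff {U₁ U₂ : Subrepresentation ρ} :
    IsCompl U₁.toSubmodule U₂.toSubmodule ↔ IsCompl U₁ U₂ := by
  rw [isCompl_iff, isCompl_iff, disjoint_iff, disjoint_iff, codisjoint_iff, codisjoint_iff]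
  exact ⟨fun h => ⟨toSubmodule_injective h.1, toSubmodule_injective h.2⟩,
    fun h => ⟨congrArg toSubmodule h.1, congrArg toSubmodule h.2⟩⟩

lemma exists_ne_zero_of_ne_bot {U : Subrepresentation ρ} (hU : U ≠ ⊥) :
    ∃ v ∈ U.toSubmodule, v ≠ 0 :=
  U.toSubmodule.exists_mem_ne_zero_of_ne_bot fun h => hU (toSubmodule_eq_bot_iff.1 h)

end Subrepresentation

namespace Representation

section Indecomposable

variable {k G V W : Type*} [Field k] [Group G] [AddCommGroup V] [Module k V]
  [AddCommGroup W] [Module k W]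

/-- Indecomposability is transported along an equivariant linear isomorphism. -/
lemma IsIndecomposable.of_linearEquiv {ρ : Representation k G V} {τ : Representation k G W}
    (e : V ≃ₗ[k] W) (he : ∀ g v, e (ρ g v) = τ g (e v)) (h : ρ.IsIndecomposable) :
    τ.IsIndecomposable := by
  obtain ⟨h1, h2⟩ := h
  refine ⟨e.symm.toEquiv.nontrivial, fun U₁ U₂ hU => ?_⟩
  let c : Subrepresentation τ → Subrepresentation ρ := fun U =>
    ⟨U.toSubmodule.comap e.toLinearMap, fun g v hv => by
      simpa [he] using U.apply_mem_toSubmodule g hv⟩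
  have hc : ∀ U, c U = ⊥ → U = ⊥ := fun U hU => by
    rw [← Subrepresentation.toSubmodule_eq_bot_iff] at hU ⊢
    rw [eq_bot_iff]
    intro w hw
    have : e.symm w ∈ (c U).toSubmodule := by simpa [c] using hw
    simpa [hU] using this
  refine (h2 (c U₁) (c U₂) ?_).imp (hc _) (hc _)
  rw [← Subrepresentation.isCompl_toSubmodule_iff] at hU ⊢
  exact (Submodule.orderIsoMapComap e).symm.isCompl_iff.1 hU

end Indecomposable

/-! ### Fixed vectors of `p`-groups in characteristic `p` -/

section FixedVectors

variable {k G V : Type*} [Field k] [Group G] [AddCommGroup V] [Module k V]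

open MulAction in
/-- A nonzero module for a `p`-group in characteristic `p` has a nonzero fixed vector. -/
lemma exists_ne_zero_fixed_of_isPGroup (p : ℕ) [Fact p.Prime] [CharP k p] [Finite G]
    (hG : IsPGroup p G) {ρ : Representation k G V} {U : Subrepresentation ρ} (hU : U ≠ ⊥) :
    ∃ v ∈ U.toSubmodule, v ≠ 0 ∧ ∀ g, ρ g v = v := by
  obtain ⟨v, hv, hv0⟩ := Subrepresentation.exists_ne_zero_of_ne_bot hU
  -- Orbit counting needs a finite set, but `k` may be infinite. The additive span of one orbit is
  -- finite: it is finitely generated and killed by `p`.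
  let A : AddSubgroup V := AddSubgroup.closure (Set.range fun g => ρ g v)
  have hAρ : ∀ g, ∀ a ∈ A, ρ g a ∈ A := by
    intro g a ha
    induction ha using AddSubgroup.closure_induction with
    | mem x hx =>
      obtain ⟨h, rfl⟩ := hx
      exact AddSubgroup.subset_closure ⟨g * h, by simp⟩
    | zero => simp
    | add x y _ _ hx hy => simpa using add_mem hx hy
    | neg x _ hx => simpa using hx
  have hAU : ∀ a ∈ A, a ∈ U.toSubmodule := fun a ha => by
    have : A ≤ U.toSubmodule.toAddSubgroup := by
      rw [AddSubgroup.closure_le]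
      rintro _ ⟨g, rfl⟩
      exact U.apply_mem_toSubmodule g hv
    exact this ha
  have hp : ∀ a : A, p • a = 0 := fun a => Subtype.ext <| by
    rw [AddSubgroup.coe_nsmul, ← Nat.cast_smul_eq_nsmul k]
    simp
  have hvA : v ∈ A := AddSubgroup.subset_closure ⟨1, by simp⟩
  have hfg : AddGroup.FG A := (AddGroup.fg_iff_addSubgroup_fg A).2
    ((AddSubgroup.fg_iff _).2 ⟨_, rfl, Set.finite_range _⟩)
  have hfin : Finite A := AddCommGroup.finite_of_fg_isAddTorsion A fun a =>
    isOfFinAddOrder_iff_nsmul_eq_zero.2 ⟨p, (Fact.out : p.Prime).pos, hp a⟩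
  let _ : MulAction G A :=
    { smul g a := ⟨ρ g a, hAρ g a a.2⟩
      one_smul a := Subtype.ext (by simp [HSMul.hSMul])
      mul_smul g h a := Subtype.ext (by simp [HSMul.hSMul]) }
  have hcard : p ∣ Nat.card A := by
    have h1 : addOrderOf (⟨v, hvA⟩ : A) = p := addOrderOf_eq_prime (hp _) fun h =>
      hv0 (congrArg Subtype.val h)
    exact h1 ▸ addOrderOf_dvd_natCard _
  obtain ⟨b, hb, hb0⟩ := hG.exists_fixed_point_of_prime_dvd_card_of_fixed_point A hcard
    (a := 0) (fun g => Subtype.ext (map_zero (ρ g)))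
  exact ⟨b, hAU b b.2, fun h => hb0 (Subtype.ext h.symm), fun g => congrArg Subtype.val (hb g)⟩

/-- A group acting through a `p`-group in characteristic `p` has a nonzero fixed vector in every
nonzero submodule. -/
lemma exists_ne_zero_fixed (p : ℕ) [Fact p.Prime] [CharP k p] [Finite G]
    {ρ : Representation k G V} (hρ : ∀ g, ∃ n, ρ (g ^ p ^ n) = 1)
    {U : Subrepresentation ρ} (hU : U ≠ ⊥) :
    ∃ v ∈ U.toSubmodule, v ≠ 0 ∧ ∀ g, ρ g v = v := by
  -- The image of `G` in the units of `End V` is a finite `p`-group with the same fixed vectors.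
  let f := ρ.toHomUnits
  have hf : ∀ g, (f g : Module.End k V) = ρ g := fun _ => rfl
  have hG : IsPGroup p f.range := isPGroup_iff_pow_pow_eq_one.2 fun x => by
    obtain ⟨g, hg⟩ := x.2
    obtain ⟨n, hn⟩ := hρ g
    refine ⟨n, Subtype.ext (Units.ext ?_)⟩
    rw [SubmonoidClass.coe_pow, ← hg, ← map_pow, hf, hn]
    rfl
  have : Finite f.range := Finite.of_surjective _ f.rangeRestrict_surjective
  let U' : Subrepresentation ((Units.coeHom (Module.End k V)).comp f.range.subtype) :=
    ⟨U.toSubmodule, fun ⟨_, g, hg⟩ v hv => by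
      subst hg
      exact U.apply_mem_toSubmodule g hv⟩
  have hU' : U' ≠ ⊥ := fun h => hU <| Subrepresentation.toSubmodule_eq_bot_iff.1
      (Subrepresentation.toSubmodule_eq_bot_iff.2 h : U'.toSubmodule = ⊥)
  obtain ⟨v, hv, hv0, h⟩ := exists_ne_zero_fixed_of_isPGroup p hG hU'
  exact ⟨v, hv, hv0, fun g => h ⟨f g, g, rfl⟩⟩

end FixedVectors

/-! ### Permutation modules: transitivity and indecomposability -/

section PermutationBasis

variable {k G V X : Type*} [Field k] [Group G] [AddCommGroup V] [Module k V] [MulAction G X]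
  {ρ : Representation k G V} {b : Module.Basis X k V}

lemma repr_apply_of_permutes (hb : ∀ g x, ρ g (b x) = b (g • x)) (g : G) (v : V) (y : X) :
    b.repr (ρ g v) y = b.repr v (g⁻¹ • y) := by
  classical
  have : (Finsupp.lapply y ∘ₗ b.repr.toLinearMap) ∘ₗ ρ g =
      Finsupp.lapply (g⁻¹ • y) ∘ₗ b.repr.toLinearMap := b.ext fun x => by
    simp [hb, Finsupp.single_apply, eq_inv_smul_iff]
  exact LinearMap.congr_fun this v

lemma apply_eq_one_iff_of_permutes (hb : ∀ g x, ρ g (b x) = b (g • x)) (g : G) :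
    ρ g = 1 ↔ ∀ x : X, g • x = x := by
  refine ⟨fun h x => b.injective ?_, fun h => b.ext fun x => ?_⟩
  · rw [← hb, h, Module.End.one_apply]
  · rw [hb, h, Module.End.one_apply]

/-- If a group acting through a `p`-group permutes a basis transitively, then two nonzero
submodules meet. -/
lemma not_disjoint_of_permutes (p : ℕ) [Fact p.Prime] [CharP k p] [Finite G]
    [MulAction.IsPretransitive G X] (hb : ∀ g x, ρ g (b x) = b (g • x))
    (hρ : ∀ g, ∃ n, ρ (g ^ p ^ n) = 1) {U₁ U₂ : Subrepresentation ρ}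
    (h₁ : U₁ ≠ ⊥) (h₂ : U₂ ≠ ⊥) : ¬ Disjoint U₁.toSubmodule U₂.toSubmodule := by
  obtain ⟨v, hv, hv0, hvf⟩ := exists_ne_zero_fixed p hρ h₁
  obtain ⟨w, hw, hw0, hwf⟩ := exists_ne_zero_fixed p hρ h₂
  -- By transitivity a fixed vector has constant coordinates, so any two fixed vectors are
  -- proportional.
  have key : ∀ u : V, (∀ g, ρ g u = u) → ∀ x y, b.repr u x = b.repr u y := by
    intro u hu x y
    obtain ⟨g, rfl⟩ := MulAction.exists_smul_eq G y x
    rw [← hu g, repr_apply_of_permutes hb, inv_smul_smul, hu]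
  obtain ⟨x, hx⟩ : ∃ x, b.repr v x ≠ 0 := by
    by_contra! h
    exact hv0 (b.repr.map_eq_zero_iff.1 (Finsupp.ext h))
  intro hd
  have h1 : b.repr v x • w = b.repr w x • v := b.repr.injective <| Finsupp.ext fun y => by
    simp [key v hvf y x, key w hwf y x, mul_comm]
  have h2 : b.repr v x • w = 0 := Submodule.disjoint_def.1 hd _
    (h1 ▸ U₁.toSubmodule.smul_mem _ hv) (U₂.toSubmodule.smul_mem _ hw)
  exact (smul_ne_zero hx hw0) h2

lemma isIndecomposable_of_permutes (p : ℕ) [Fact p.Prime] [CharP k p] [Finite G] [Nonempty X]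
    [MulAction.IsPretransitive G X] (hb : ∀ g x, ρ g (b x) = b (g • x))
    (hρ : ∀ g, ∃ n, ρ (g ^ p ^ n) = 1) : ρ.IsIndecomposable := by
  refine ⟨⟨b (Classical.arbitrary X), 0, b.ne_zero _⟩, fun U₁ U₂ hU => ?_⟩
  by_contra! h
  exact not_disjoint_of_permutes p hb hρ h.1 h.2
    (Subrepresentation.isCompl_toSubmodule_iff.2 hU).disjoint

/-- An orbit and its complement span complementary submodules, both nonzero if there is more than
one orbit. -/
lemma IsIndecomposable.isPretransitive (hρ : ρ.IsIndecomposable)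
    (hb : ∀ g x, ρ g (b x) = b (g • x)) : MulAction.IsPretransitive G X := by
  by_contra hX
  obtain ⟨x, y, hxy⟩ : ∃ x y : X, ∀ g : G, g • x ≠ y := by
    by_contra! h
    exact hX ⟨h⟩
  let U : (s : Set X) → (∀ (g : G), ∀ z ∈ s, g • z ∈ s) → Subrepresentation ρ := fun s hs =>
    ⟨Submodule.span k (b '' s), fun g v hv => by
      have : Submodule.span k (b '' s) ≤ (Submodule.span k (b '' s)).comap (ρ g) := by
        rw [Submodule.span_le]
        rintro _ ⟨z, hz, rfl⟩
        simp only [Submodule.comap_coe, Set.mem_preimage, hb]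
        exact Submodule.subset_span ⟨_, hs g z hz, rfl⟩
      exact this hv⟩
  have hU0 : ∀ s hs z, z ∈ s → U s hs ≠ ⊥ := fun s hs z hz h => by
    have h1 : b z ∈ (U s hs).toSubmodule := Submodule.subset_span ⟨z, hz, rfl⟩
    rw [Subrepresentation.toSubmodule_eq_bot_iff.2 h] at h1
    exact b.ne_zero z (by simpa using h1)
  have hs : ∀ g : G, ∀ z ∈ MulAction.orbit G x, g • z ∈ MulAction.orbit G x :=
    fun g z hz => MulAction.mem_orbit_of_mem_orbit g hz
  have hs' : ∀ g : G, ∀ z ∈ (MulAction.orbit G x)ᶜ, g • z ∈ (MulAction.orbit G x)ᶜ :=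
    fun g z hz h => hz (by simpa using MulAction.mem_orbit_of_mem_orbit g⁻¹ h)
  have hc : IsCompl (U _ hs) (U _ hs') := by
    rw [← Subrepresentation.isCompl_toSubmodule_iff]
    refine ⟨b.linearIndependent.disjoint_span_image disjoint_compl_right, ?_⟩
    rw [codisjoint_iff, ← Submodule.span_union, ← Set.image_union, Set.union_compl_self,
      Set.image_univ, b.span_eq]
  rcases hρ.2 _ _ hc with h | h
  · exact hU0 _ hs x (MulAction.mem_orbit_self x) h
  · exact hU0 _ hs' y (fun ⟨g, hg⟩ => hxy g hg) h

end PermutationBasis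

end Representation

/-! ### Stabilizers of cosets -/

namespace QuotientGroup

variable {G : Type*} [Group G]

lemma smul_mk_one_eq_iff {L : Subgroup G} (g : G) : g • ((1 : G) : G ⧸ L) = (1 : G) ↔ g ∈ L := by
  rw [MulAction.Quotient.smul_mk, smul_eq_mul, mul_one, eq_comm, QuotientGroup.eq, inv_one, one_mul]

lemma smul_eq_self_iff {L : Subgroup G} [L.Normal] (g : G) (x : G ⧸ L) : g • x = x ↔ g ∈ L := by
  obtain ⟨a, rfl⟩ := QuotientGroup.mk_surjective x
  rw [MulAction.Quotient.smul_mk, eq_comm, QuotientGroup.eq, smul_eq_mul, ← mul_assoc]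
  exact ⟨fun h => by simpa [mul_assoc] using ‹L.Normal›.conj_mem _ h a,
    fun h => by simpa using ‹L.Normal›.conj_mem _ h a⁻¹⟩

lemma smul_eq_self_of_mem {K L : Subgroup G} [K.Normal] (hKL : K ≤ L) {g : G} (hg : g ∈ K)
    (x : G ⧸ L) : g • x = x := by
  obtain ⟨a, rfl⟩ := QuotientGroup.mk_surjective x
  rw [MulAction.Quotient.smul_mk, eq_comm, QuotientGroup.eq, smul_eq_mul, ← mul_assoc]
  exact hKL (by simpa using ‹K.Normal›.conj_mem _ hg a⁻¹)

end QuotientGroup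

namespace Representation

/-! ### The Brauer construction of a permutation module -/

section Brauer

variable {k G V : Type*} [Field k] [Group G] [AddCommGroup V] [Module k V]
  {ρ : Representation k G V} {Q : Subgroup G}

lemma fixedBy_eq_top_of_le_ker (h : Q ≤ MonoidHom.ker ρ) : ρ.fixedBy Q = ⊤ :=
  eq_top_iff.2 fun v _ => mem_fixedBy.2 fun g hg => by
    rw [MonoidHom.mem_ker.1 (h hg), Module.End.one_apply]

/-- On a trivial `Q`-module the relative trace from `R` is multiplication by `|Q : R|`, which `p`
divides when `R < Q`. -/
lemma traceSum_eq_bot_of_le_ker (p : ℕ) [Fact p.Prime] [CharP k p] [Finite G]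
    (hQ : IsPGroup p Q) (h : Q ≤ MonoidHom.ker ρ) : ρ.traceSum Q = ⊥ := by
  classical
  simp only [traceSum, iSup_eq_bot]
  intro R hR
  rw [eq_bot_iff]
  rintro _ ⟨v, -, rfl⟩
  have := Fintype.ofFinite (Q ⧸ R.subgroupOf Q)
  have h1 : ∀ x : Q ⧸ R.subgroupOf Q, ρ (x.out : Q) v = v := fun x => by
    rw [MonoidHom.mem_ker.1 (h x.out.2), Module.End.one_apply]
  have h2 : p ∣ Nat.card (Q ⧸ R.subgroupOf Q) := by
    obtain ⟨n, hn⟩ := hQ.index (R.subgroupOf Q)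
    rw [← Subgroup.index, hn]
    refine dvd_pow_self p fun h0 => ?_
    rw [h0, pow_zero, Subgroup.index_eq_one, Subgroup.subgroupOf_eq_top] at hn
    exact hR.not_ge hn
  rw [Submodule.mem_bot, relTrace_apply, finsum_eq_sum_of_fintype, Finset.sum_congr rfl
    fun x _ => h1 x, Finset.sum_const, Finset.card_univ, ← Nat.card_eq_fintype_card,
    ← Nat.cast_smul_eq_nsmul k, (CharP.cast_eq_zero_iff k p _).2 h2, zero_smul]

lemma not_subsingleton_brauer_of_le_ker (p : ℕ) [Fact p.Prime] [CharP k p] [Finite G]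
    [Nontrivial V] (hQ : IsPGroup p Q) (h : Q ≤ MonoidHom.ker ρ) :
    ¬ Subsingleton (ρ.fixedBy Q ⧸ (ρ.traceSum Q).submoduleOf (ρ.fixedBy Q)) := by
  rw [Submodule.Quotient.subsingleton_iff, Submodule.submoduleOf_eq_top,
    traceSum_eq_bot_of_le_ker p hQ h, fixedBy_eq_top_of_le_ker h, le_bot_iff]
  exact top_ne_bot

/-- If a `p`-subgroup `Q` acts trivially on `M`, then `M(Q)` is the restriction of `M`. -/
lemma isIndecomposable_brauer_comp_iff (p : ℕ) [Fact p.Prime] [CharP k p] [Finite G]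
    (hQ : IsPGroup p Q) (h : Q ≤ MonoidHom.ker ρ)
    (H : Subgroup (Subgroup.normalizer (Q : Set G))) :
    IsIndecomposable ((ρ.brauer Q).comp H.subtype) ↔
      IsIndecomposable (ρ.comp ((Subgroup.normalizer (Q : Set G)).subtype.comp H.subtype)) := by
  have hbot : (ρ.traceSum Q).submoduleOf (ρ.fixedBy Q) = ⊥ := by
    rw [traceSum_eq_bot_of_le_ker p hQ h, eq_bot_iff]
    exact fun v hv => Subtype.ext hv
  let e := (Submodule.quotEquivOfEqBot _ hbot).trans
    (LinearEquiv.ofTop _ (fixedBy_eq_top_of_le_ker h))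
  have he : ∀ (g : H) v, e (((ρ.brauer Q).comp H.subtype) g v) =
      (ρ.comp ((Subgroup.normalizer (Q : Set G)).subtype.comp H.subtype)) g (e v) := by
    intro g v
    obtain ⟨v, rfl⟩ := Submodule.Quotient.mk_surjective _ v
    rfl
  exact ⟨fun h => h.of_linearEquiv e he, fun h => h.of_linearEquiv e.symm fun g v =>
    e.injective (by rw [he, e.apply_symm_apply, e.apply_symm_apply])⟩

/-- If `M` has a basis permuted as `G ⧸ L` with `L` normal, then `M(Q) = 0` unless `Q ≤ L`. -/
lemma fixedBy_le_traceSum_of_permutes [Finite G] {L : Subgroup G} [L.Normal]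
    {b : Module.Basis (G ⧸ L) k V} (hb : ∀ g x, ρ g (b x) = b (g • x)) (hQ : ¬ Q ≤ L) :
    ρ.fixedBy Q ≤ ρ.traceSum Q := by
  classical
  intro v hv
  -- `r` picks a representative of each `Q`-orbit, and `w` below is the part of `v` supported on
  -- representatives. As `L` is normal, every point has stabilizer `Q ⊓ L` in `Q`, so the trace of
  -- `w` from `Q ⊓ L` recovers `v`.
  let r : G ⧸ L → G ⧸ L := fun x => (Quotient.mk (MulAction.orbitRel Q (G ⧸ L)) x).out
  have hr : ∀ x, ∃ q : Q, (q : G) • r x = x := fun x =>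
    (MulAction.orbitRel Q (G ⧸ L)).symm (Quotient.mk_out (s := MulAction.orbitRel Q (G ⧸ L)) x)
  have hrq : ∀ (q : Q) x, r ((q : G) • x) = r x := fun q x =>
    congrArg Quotient.out (Quotient.sound (s := MulAction.orbitRel Q (G ⧸ L)) ⟨q, rfl⟩)
  have hrr : ∀ x, r (r x) = r x := fun x => by
    obtain ⟨q, hq⟩ := hr x
    rw [← hrq q, hq]
  let w : V := b.repr.symm ((b.repr v).filter fun x => r x = x)
  have hw : ∀ x, b.repr w x = if r x = x then b.repr v x else 0 := fun x => by
    simp [w, Finsupp.filter_apply]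
  have hvq : ∀ (q : Q) x, b.repr v ((q : G)⁻¹ • x) = b.repr v x := fun q x => by
    rw [← repr_apply_of_permutes hb, mem_fixedBy.1 hv q q.2]
  have hwR : w ∈ ρ.fixedBy (Q ⊓ L) := mem_fixedBy.2 fun g hg => by
    rw [(apply_eq_one_iff_of_permutes hb g).2 fun x =>
      (QuotientGroup.smul_eq_self_iff g x).2 hg.2, Module.End.one_apply]
  have hlt : Q ⊓ L < Q := lt_of_le_of_ne inf_le_left fun h => hQ (inf_eq_left.1 h)
  refine Submodule.mem_iSup_of_mem (Q ⊓ L) (Submodule.mem_iSup_of_mem hlt ⟨w, hwR, ?_⟩)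
  have := Fintype.ofFinite (Q ⧸ (Q ⊓ L).subgroupOf Q)
  refine b.repr.injective (Finsupp.ext fun y => ?_)
  rw [relTrace_apply, finsum_eq_sum_of_fintype, map_sum, Finsupp.finsetSum_apply]
  have hterm : ∀ q : Q, b.repr (ρ q w) y = if r y = (q : G)⁻¹ • y then b.repr v y else 0 := by
    intro q
    rw [repr_apply_of_permutes hb, hw, hvq, ← Subgroup.coe_inv, hrq]
  obtain ⟨q, hq⟩ := hr y
  -- Exactly one coset of `Q ⊓ L` carries `r y` to `y`, so a single term of the trace survives at
  -- `y`.
  have hiff : ∀ q' : Q, r y = (q' : G)⁻¹ • y ↔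
      (QuotientGroup.mk q : Q ⧸ (Q ⊓ L).subgroupOf Q) = QuotientGroup.mk q' := by
    intro q'
    have hmem : q⁻¹ * q' ∈ (Q ⊓ L).subgroupOf Q ↔ (q : G)⁻¹ * q' ∈ L := by
      simp [Subgroup.mem_subgroupOf]
    rw [QuotientGroup.eq, hmem, ← QuotientGroup.smul_eq_self_iff _ (r y), mul_smul,
      inv_smul_eq_iff, hq, eq_inv_smul_iff]
  rw [Finset.sum_eq_single (QuotientGroup.mk q), hterm, if_pos]
  · rw [hiff, QuotientGroup.out_eq']
  · intro x _ hx
    rw [hterm, if_neg]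
    rw [hiff, QuotientGroup.out_eq']
    exact hx.symm
  · exact fun h => (h (Finset.mem_univ _)).elim

lemma subsingleton_brauer_of_permutes [Finite G] {L : Subgroup G} [L.Normal]
    {b : Module.Basis (G ⧸ L) k V} (hb : ∀ g x, ρ g (b x) = b (g • x)) (hQ : ¬ Q ≤ L) :
    Subsingleton (ρ.fixedBy Q ⧸ (ρ.traceSum Q).submoduleOf (ρ.fixedBy Q)) :=
  Submodule.Quotient.subsingleton_iff.2 <|
    Submodule.submoduleOf_eq_top.2 (fixedBy_le_traceSum_of_permutes hb hQ)

lemma IsIndecomposable.sup_eq_top_of_permutes {H L : Subgroup G} {Γ : Type*} [Group Γ]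
    {f : Γ →* G} (hf : f.range ≤ H) {b : Module.Basis (G ⧸ L) k V}
    (hb : ∀ g x, ρ g (b x) = b (g • x)) (h : IsIndecomposable (ρ.comp f)) : H ⊔ L = ⊤ := by
  let _ : MulAction Γ (G ⧸ L) := MulAction.compHom _ f
  have ht : MulAction.IsPretransitive Γ (G ⧸ L) := h.isPretransitive fun g x => hb (f g) x
  refine eq_top_iff.2 fun g _ => ?_
  obtain ⟨a, ha⟩ := ht.exists_smul_eq ((1 : G) : G ⧸ L) (g : G ⧸ L)
  have ha' : ((f a * 1 : G) : G ⧸ L) = g := ha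
  rw [mul_one, QuotientGroup.eq] at ha'
  have := mul_mem (Subgroup.mem_sup_left (hf ⟨a, rfl⟩) : f a ∈ H ⊔ L) (Subgroup.mem_sup_right ha')
  simpa using this

/-- Since `L` acts trivially on `G ⧸ L`, a subgroup covering `G` modulo `L` is still transitive
there, and it acts through the `p`-group `G ⧸ L`. -/
lemma isIndecomposable_comp_of_permutes (p : ℕ) [Fact p.Prime] [CharP k p]
    {H L : Subgroup G} [L.Normal] {Γ : Type*} [Group Γ] [Finite Γ]
    (hGL : IsPGroup p (G ⧸ L)) {f : Γ →* G} (hf : H ≤ f.range) {b : Module.Basis (G ⧸ L) k V}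
    (hb : ∀ g x, ρ g (b x) = b (g • x)) (h : H ⊔ L = ⊤) : IsIndecomposable (ρ.comp f) := by
  let _ : MulAction Γ (G ⧸ L) := MulAction.compHom _ f
  have ht : MulAction.IsPretransitive Γ (G ⧸ L) := ⟨fun x y => by
    obtain ⟨g, rfl⟩ := MulAction.exists_smul_eq G x y
    have hg : g ∈ ((H ⊔ L : Subgroup G) : Set G) := h ▸ Subgroup.mem_top g
    rw [Subgroup.mul_normal] at hg
    obtain ⟨a, ha, l, hl, rfl⟩ := hg
    obtain ⟨c, rfl⟩ := hf ha
    refine ⟨c, ?_⟩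
    change f c • x = (f c * l) • x
    rw [mul_smul, (QuotientGroup.smul_eq_self_iff l x).2 hl]⟩
  refine isIndecomposable_of_permutes p (b := b) (fun g x => hb (f g) x) fun g => ?_
  obtain ⟨n, hn⟩ := isPGroup_iff_pow_pow_eq_one.1 hGL (f g : G ⧸ L)
  refine ⟨n, (apply_eq_one_iff_of_permutes hb _).2 fun x => ?_⟩
  rw [QuotientGroup.smul_eq_self_iff, map_pow, ← QuotientGroup.eq_one_iff, QuotientGroup.mk_pow, hn]

end Brauer

/-! ### Scott modules of `p`-nilpotent groups -/

section Scott

variable {k G V W : Type*} [Field k] [Group G] [AddCommGroup V] [Module k V]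
  [AddCommGroup W] [Module k W]

lemma IsSummandOf.exists_section {ρ : Representation k G V} {σ : Representation k G W}
    (h : ρ.IsSummandOf σ) : ∃ (i : V →ₗ[k] W) (π : W →ₗ[k] V), (∀ g v, i (ρ g v) = σ g (i v)) ∧
      (∀ g w, π (σ g w) = ρ g (π w)) ∧ ∀ v, π (i v) = v := by
  obtain ⟨U₁, U₂, hU, ⟨e⟩⟩ := h
  have hc := Subrepresentation.isCompl_toSubmodule_iff.2 hU
  have he : ∀ g v, (e (ρ g v) : W) = σ g (e v) := fun g v =>
    congrArg Subtype.val (IntertwiningMap.isIntertwining _ _ e.toIntertwiningMap g v)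
  have hp : ∀ g w, Submodule.projectionOnto _ _ hc (σ g w) =
      U₁.toRepresentation g (Submodule.projectionOnto _ _ hc w) := by
    intro g w
    obtain ⟨u₁, h₁, u₂, h₂, rfl⟩ := Submodule.mem_sup.1
      (hc.sup_eq_top ▸ Submodule.mem_top : w ∈ U₁.toSubmodule ⊔ U₂.toSubmodule)
    have k₁ := U₁.apply_mem_toSubmodule g h₁
    have k₂ := U₂.apply_mem_toSubmodule g h₂
    rw [map_add, map_add, map_add, Submodule.projectionOnto_apply_of_mem_right hc h₂,
      Submodule.projectionOnto_apply_of_mem_right hc k₂, add_zero, add_zero]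
    rw [Submodule.projectionOnto_apply_of_mem_left hc h₁,
      Submodule.projectionOnto_apply_of_mem_left hc k₁]
    rfl
  refine ⟨U₁.toSubmodule.subtype ∘ₗ e.toLinearEquiv.toLinearMap,
    e.toLinearEquiv.symm.toLinearMap ∘ₗ Submodule.projectionOnto _ _ hc, he, fun g w => ?_,
    fun v => ?_⟩
  · apply e.toLinearEquiv.injective
    refine Subtype.ext ((he _ _).trans ?_).symm
    rw [LinearMap.comp_apply, LinearMap.comp_apply, hp]
    refine (congrArg (fun u => σ g (Subtype.val u)) (e.toLinearEquiv.apply_symm_apply _)).trans ?_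
    exact (congrArg Subtype.val (e.toLinearEquiv.apply_symm_apply (U₁.toRepresentation g
      (Submodule.projectionOnto _ _ hc w)))).symm
  · exact (congrArg e.toLinearEquiv.symm (Submodule.projectionOnto_apply_left hc (e v))).trans
      (e.toLinearEquiv.symm_apply_apply v)

/-- A normal `p'`-subgroup acts trivially on a Scott module. -/
lemma IsScottModule.le_ker [Finite G] {P K : Subgroup G} [K.Normal]
    (hK : (Nat.card K : k) ≠ 0) {ρ : Representation k G V} (h : IsScottModule P ρ) :
    K ≤ MonoidHom.ker ρ := by
  classical
  obtain ⟨hind, -, U, ⟨e⟩⟩ := h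
  have := Fintype.ofFinite K
  rw [Nat.card_eq_fintype_card] at hK
  have : Invertible (Fintype.card K : k) := invertibleOfNonzero hK
  let a := averageMap (ρ.comp K.subtype)
  have ha : ∀ v, a v = ⅟(Fintype.card K : k) • ∑ x : K, ρ x v := fun v => by
    simp [a, GroupAlgebra.average]
  -- Normality of `K` lets conjugation by `g` permute the summands, so both the image and the kernel
  -- of the average are `G`-stable.
  have haρ : ∀ g v, a (ρ g v) = ρ g (a v) := fun g v => by
    rw [ha, ha, map_smul, map_sum, ← (MulAut.conjNormal (H := K) g).toEquiv.sum_comp]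
    congr 1
    refine Finset.sum_congr rfl fun x _ => ?_
    simp only [← Module.End.mul_apply, ← map_mul]
    simp
  have hproj := isProj_averageMap (ρ.comp K.subtype)
  let U₁ : Subrepresentation ρ := ⟨invariants (ρ.comp K.subtype), fun g v hv => by
    have : a v = v := hproj.map_id v hv
    rw [← this, ← haρ]
    exact hproj.map_mem _⟩
  let U₂ : Subrepresentation ρ := ⟨LinearMap.ker a, fun g v hv => by
    rw [LinearMap.mem_ker] at hv ⊢
    rw [haρ, hv, map_zero]⟩
  have hc : IsCompl U₁ U₂ := Subrepresentation.isCompl_toSubmodule_iff.1 hproj.isCompl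
  have h₁ : U₁ ≠ ⊥ := fun h0 => by
    have hm : (e 1 : V) ∈ U₁.toSubmodule := fun g =>
      (congrArg Subtype.val
        (IntertwiningMap.isIntertwining _ _ e.toIntertwiningMap (g : G) 1)).symm
    rw [Subrepresentation.toSubmodule_eq_bot_iff.2 h0, Submodule.mem_bot] at hm
    have : e 1 = 0 := Subtype.ext hm
    exact one_ne_zero (e.toLinearEquiv.injective (this.trans (map_zero e.toLinearEquiv).symm))
  have h₂ := (hind.2 _ _ hc).resolve_left h₁
  have ht : U₁.toSubmodule = ⊤ := by
    simpa [Subrepresentation.toSubmodule_eq_bot_iff.2 h₂] using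
      (Subrepresentation.isCompl_toSubmodule_iff.2 hc).sup_eq_top
  intro g hg
  refine LinearMap.ext fun v => ?_
  exact (ht ▸ Submodule.mem_top : v ∈ U₁.toSubmodule) ⟨g, hg⟩

open MonoidAlgebra in
/-- The map `Ind_P^G k → k[G ⧸ L]` for `P ≤ L`. -/
noncomputable def indTrivialToQuotient (k : Type*) [Field k] {P L : Subgroup G} (hPL : P ≤ L) :
    IndV P.subtype (trivial k P k) →ₗ[k] MonoidAlgebra k (G ⧸ L) :=
  Coinvariants.lift _
    -- The group acts on the induced module by right multiplication with `g⁻¹`; inversion turns this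
    -- into left multiplication on cosets.
    (mapDomainLinearMap k k (fun h : G => ((h⁻¹ : G) : G ⧸ L)) ∘ₗ
      (_root_.TensorProduct.rid k (MonoidAlgebra k G)).toLinearMap) fun x => by
    have hx : ∀ h : G, ((h⁻¹ * (x : G)⁻¹ : G) : G ⧸ L) = (h⁻¹ : G) := fun h =>
      QuotientGroup.eq.2 (by simpa using hPL x.2)
    ext h
    simp [hx]

lemma indTrivialToQuotient_mk {P L : Subgroup G} (hPL : P ≤ L) (h : G) (a : k) :
    indTrivialToQuotient k hPL (IndV.mk _ _ h a) =
      MonoidAlgebra.single ((h⁻¹ : G) : G ⧸ L) a := by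
  simp [indTrivialToQuotient]

/-- For a group with normal `p`-complement `K`, the Scott module with respect to `P` is the
permutation module on `G ⧸ KP`. -/
lemma IsScottModule.exists_basis (p : ℕ) [Fact p.Prime] [CharP k p] [Finite G]
    {P K : Subgroup G} [K.Normal] (hK : (Nat.card K).Coprime p) (hGK : IsPGroup p (G ⧸ K))
    {ρ : Representation k G V} (h : IsScottModule P ρ) :
    ∃ b : Module.Basis (G ⧸ (K ⊔ P)) k V, ∀ g x, ρ g (b x) = b (g • x) := by
  have hKρ : K ≤ MonoidHom.ker ρ := h.le_ker fun h0 =>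
    (Fact.out : p.Prime).ne_one
      (hK.symm.eq_one_of_dvd ((CharP.cast_eq_zero_iff k p _).1 h0))
  obtain ⟨i, π, hi, hπ, hπi⟩ := h.2.1.exists_section
  -- The image of the generator of the induced module: `P` fixes it by construction and `K` by
  -- triviality of its action, so `gKP ↦ g m` is well defined.
  let m : V := π (IndV.mk _ _ 1 1)
  have hm : ∀ g, π (IndV.mk _ _ g 1) = ρ g⁻¹ m := fun g => by
    rw [← hπ, ind_mk, one_mul, inv_inv]
  have hstab : ∀ g ∈ K ⊔ P, ρ g m = m := by
    let S : Subgroup G :=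
      { carrier := {g | ρ g m = m}
        one_mem' := by simp
        mul_mem' := fun {a c} ha hc => by
          rw [Set.mem_ofPred_eq] at ha hc ⊢
          rw [map_mul, Module.End.mul_apply, hc, ha]
        inv_mem' := fun {a} ha => by
          rw [Set.mem_ofPred_eq] at ha ⊢
          nth_rewrite 1 [← ha]
          rw [← Module.End.mul_apply, ← map_mul, inv_mul_cancel, map_one, Module.End.one_apply] }
    have hS : K ⊔ P ≤ S := sup_le (fun g hg => by
      change ρ g m = m
      rw [MonoidHom.mem_ker.1 (hKρ hg), Module.End.one_apply]) fun g hg => by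
      change ρ g m = m
      have h1 := hm g⁻¹
      rw [inv_inv] at h1
      rw [← h1]
      refine congrArg π ?_
      have := Coinvariants.mk_self_apply
        (tprod ((leftRegular k G).comp P.subtype) (trivial k P k)) ⟨g⁻¹, inv_mem hg⟩
        (MonoidAlgebra.single 1 1 ⊗ₜ 1)
      simpa using this
    exact fun g hg => hS hg
  let c : Module.Basis (G ⧸ (K ⊔ P)) k (MonoidAlgebra k (G ⧸ (K ⊔ P))) :=
    .ofRepr (MonoidAlgebra.coeffLinearEquiv k)
  have hc : ∀ x, c x = MonoidAlgebra.single x 1 := fun x => rfl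
  let τ := ofMulAction k G (G ⧸ (K ⊔ P))
  have hτ : ∀ g x, τ g (c x) = c (g • x) := fun g x => by
    rw [hc, hc, ofMulAction_single]
  let f : MonoidAlgebra k (G ⧸ (K ⊔ P)) →ₗ[k] V := c.constr k fun x => ρ x.out m
  have hfc : ∀ g : G, f (c g) = ρ g m := fun g => by
    obtain ⟨l, hl⟩ := QuotientGroup.mk_out_eq_mul (K ⊔ P) g
    rw [Module.Basis.constr_basis, hl, map_mul, Module.End.mul_apply, hstab _ l.2]
  have hf : ∀ g v, f (τ g v) = ρ g (f v) := fun g v => by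
    refine LinearMap.congr_fun (f := f ∘ₗ τ g) (g := ρ g ∘ₗ f) (c.ext fun x => ?_) v
    obtain ⟨a, rfl⟩ := QuotientGroup.mk_surjective x
    rw [LinearMap.comp_apply, LinearMap.comp_apply, hτ, hfc, MulAction.Quotient.smul_mk, hfc,
      smul_eq_mul, map_mul, Module.End.mul_apply]
  let s := indTrivialToQuotient k (le_sup_right : P ≤ K ⊔ P)
  have hfs : ∀ w, f (s w) = π w := fun w => by
    refine LinearMap.congr_fun (f := f ∘ₗ s) (g := π) (IndV.hom_ext _ _ fun g => ?_) w
    refine LinearMap.ext_ring ?_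
    change f (s (IndV.mk _ _ g 1)) = π (IndV.mk _ _ g 1)
    rw [hm, indTrivialToQuotient_mk, ← hc, hfc]
  have hs : ∀ g w, s (ind _ _ g w) = τ g (s w) := fun g w => by
    refine LinearMap.congr_fun (f := s ∘ₗ ind _ _ g) (g := τ g ∘ₗ s)
      (IndV.hom_ext _ _ fun a => ?_) w
    refine LinearMap.ext_ring ?_
    change s (ind _ _ g (IndV.mk _ _ a 1)) = τ g (s (IndV.mk _ _ a 1))
    rw [ind_mk, indTrivialToQuotient_mk, indTrivialToQuotient_mk, ofMulAction_single,
      MulAction.Quotient.smul_mk, mul_inv_rev, inv_inv, smul_eq_mul]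
  have hfi : ∀ v, f (s (i v)) = v := fun v => by rw [hfs, hπi]
  -- `f ∘ s = π` is split by `i`, so `ker f` misses the nonzero image of `s ∘ i`. Nonzero submodules
  -- of `k[G/KP]` always meet, which forces `ker f = 0`.
  let U₁ : Subrepresentation τ := ⟨LinearMap.ker f, fun g v hv => by
    rw [LinearMap.mem_ker] at hv ⊢
    rw [hf, hv, map_zero]⟩
  let U₂ : Subrepresentation τ := ⟨LinearMap.range (s ∘ₗ i), fun g v hv => by
    obtain ⟨u, rfl⟩ := hv
    exact ⟨ρ g u, by rw [LinearMap.comp_apply, LinearMap.comp_apply, hi, hs]⟩⟩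
  have hd : Disjoint U₁.toSubmodule U₂.toSubmodule := by
    rw [Submodule.disjoint_def]
    rintro _ h1 ⟨u, rfl⟩
    have h2 : f (s (i u)) = 0 := h1
    rw [hfi] at h2
    rw [h2, map_zero]
  have hU₂ : U₂ ≠ ⊥ := fun h0 => by
    have := h.1.1
    obtain ⟨u, hu⟩ := exists_ne (0 : V)
    have h1 : s (i u) ∈ U₂.toSubmodule := ⟨u, rfl⟩
    rw [Subrepresentation.toSubmodule_eq_bot_iff.2 h0, Submodule.mem_bot] at h1
    exact hu (by rw [← hfi u, h1, map_zero])
  have hU₁ : U₁ = ⊥ := by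
    by_contra h0
    refine not_disjoint_of_permutes p hτ (fun g => ?_) h0 hU₂ hd
    obtain ⟨n, hn⟩ := isPGroup_iff_pow_pow_eq_one.1 hGK (g : G ⧸ K)
    refine ⟨n, (apply_eq_one_iff_of_permutes hτ _).2
      (QuotientGroup.smul_eq_self_of_mem (K := K) le_sup_left ?_)⟩
    rw [← QuotientGroup.eq_one_iff, QuotientGroup.mk_pow, hn]
  let e := LinearEquiv.ofBijective f
    ⟨LinearMap.ker_eq_bot.1 (Subrepresentation.toSubmodule_eq_bot_iff.2 hU₁),
      fun v => ⟨s (i v), hfi v⟩⟩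
  refine ⟨c.map e, fun g x => ?_⟩
  rw [Module.Basis.map_apply, Module.Basis.map_apply]
  exact (hf g (c x)).symm.trans (congrArg f (hτ g x))

lemma IsScottModule.eq_ker_of_permutes {K P : Subgroup G} {ρ : Representation k G V}
    {b : Module.Basis (G ⧸ (K ⊔ P)) k V} (hb : ∀ g x, ρ g (b x) = b (g • x))
    (hK : K ≤ MonoidHom.ker ρ) (hP : P ≤ MonoidHom.ker ρ) : K ⊔ P = MonoidHom.ker ρ :=
  le_antisymm (sup_le hK hP) fun g hg => (QuotientGroup.smul_mk_one_eq_iff g).1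
    ((apply_eq_one_iff_of_permutes hb g).1 hg _)

end Scott
end Representation

/-! ### Sylow and Frattini arguments in `KP` -/

lemma IsPNilpotent.exists_normal_isPGroup_quotient {p : ℕ} {G : Type*} [Group G]
    (hG : IsPNilpotent p G) :
    ∃ K : Subgroup G, ∃ _ : K.Normal, (Nat.card K).Coprime p ∧ IsPGroup p (G ⧸ K) := by
  obtain ⟨K, S, hK, hcop, hKS⟩ := hG
  refine ⟨K, hK, hcop, S.2.of_surjective ((QuotientGroup.mk' K).comp (S : Subgroup G).subtype) ?_⟩
  intro x
  obtain ⟨g, rfl⟩ := QuotientGroup.mk_surjective x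
  have hg : g ∈ (((S : Subgroup G) ⊔ K : Subgroup G) : Set G) :=
    sup_comm K (S : Subgroup G) ▸ hKS ▸ Subgroup.mem_top g
  rw [Subgroup.mul_normal] at hg
  obtain ⟨s, hs, a, ha, rfl⟩ := hg
  exact ⟨⟨s, hs⟩, QuotientGroup.eq.2 (by simpa using ha)⟩

namespace Subgroup

variable {p : ℕ} [Fact p.Prime] {G : Type*} [Group G] [Finite G] {K P : Subgroup G} [K.Normal]

/-- The index of `P` in `KP` divides `|K|`, hence is prime to `p`. -/
lemma exists_sylow_sup_of_coprime (hK : (Nat.card K).Coprime p) (hP : IsPGroup p P) :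
    ∃ S : Sylow p ↥(K ⊔ P), (S : Subgroup ↥(K ⊔ P)) = P.subgroupOf (K ⊔ P) := by
  have hind : ¬ p ∣ (P.subgroupOf (K ⊔ P)).index := fun h => by
    have h1 : P.relIndex (K ⊔ P) ∣ Nat.card K := by
      have h2 := relIndex_mul_relIndex ⊥ P (K ⊔ P) bot_le le_sup_right
      have h3 := relIndex_mul_relIndex ⊥ K (K ⊔ P) bot_le le_sup_left
      rw [relIndex_bot_left] at h2 h3
      rw [relIndex_sup_left] at h3
      refine Nat.dvd_of_mul_dvd_mul_left (Nat.card_pos (α := P)) ?_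
      rw [h2, ← h3, mul_comm (Nat.card P)]
      exact mul_dvd_mul_left _ (K.relIndex_dvd_card P)
    exact (Fact.out : p.Prime).ne_one (hK.symm.eq_one_of_dvd (h.trans h1))
  exact ⟨(hP.comap_subtype).toSylow hind, IsPGroup.toSylow_coe _ _⟩

/-- The Frattini argument for the normal subgroup `KP`. -/
lemma normalizer_sup_eq_top_of_coprime (hK : (Nat.card K).Coprime p) (hP : IsPGroup p P)
    [(K ⊔ P).Normal] : normalizer (P : Set G) ⊔ (K ⊔ P) = ⊤ := by
  obtain ⟨S, hS⟩ := exists_sylow_sup_of_coprime hK hP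
  have := Sylow.normalizer_sup_eq_top S
  rwa [hS, subgroupOf_map_subtype, inf_eq_left.2 le_sup_right] at this

open Pointwise in
/-- Every `p`-subgroup of `KP` is conjugate in `KP` to a subgroup of `P`. -/
lemma exists_conj_mem_of_le_sup (hK : (Nat.card K).Coprime p) (hP : IsPGroup p P)
    {Q : Subgroup G} (hQ : IsPGroup p Q) (hQL : Q ≤ K ⊔ P) :
    ∃ x ∈ K ⊔ P, ∀ q ∈ Q, x⁻¹ * q * x ∈ P := by
  obtain ⟨S, hS⟩ := exists_sylow_sup_of_coprime hK hP
  obtain ⟨T, hT⟩ := (hQ.comap_subtype (K := K ⊔ P)).exists_le_sylow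
  obtain ⟨x, rfl⟩ := MulAction.exists_smul_eq (↥(K ⊔ P)) S T
  refine ⟨x, x.2, fun q hq => ?_⟩
  have h1 : (⟨q, hQL hq⟩ : ↥(K ⊔ P)) ∈ MulAut.conj x • (S : Subgroup ↥(K ⊔ P)) := hT hq
  rw [mem_pointwise_smul_iff_inv_smul_mem, hS, mem_subgroupOf] at h1
  simpa [← map_inv] using h1

/-- If `N_G(P)` is covered by `C_G(P)` and `KP`, then `G = C_G(Q)KP` for every `p`-subgroup `Q`
of `KP`. -/
lemma centralizer_sup_eq_top (hK : (Nat.card K).Coprime p) (hP : IsPGroup p P)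
    [(K ⊔ P).Normal] (hN : normalizer (P : Set G) ≤ centralizer (P : Set G) ⊔ (K ⊔ P))
    {Q : Subgroup G} (hQ : IsPGroup p Q) (hQL : Q ≤ K ⊔ P) :
    centralizer (Q : Set G) ⊔ (K ⊔ P) = ⊤ := by
  obtain ⟨x, hx, hxQ⟩ := exists_conj_mem_of_le_sup hK hP hQ hQL
  rw [eq_top_iff, ← normalizer_sup_eq_top_of_coprime hK hP]
  refine sup_le (hN.trans (sup_le (fun c hc => ?_) le_sup_right)) le_sup_right
  -- Since `x⁻¹Qx ≤ P`, conjugation by `x` carries `C_G(P)` into `C_G(Q)`; as `x` lies in `KP`, this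
  -- conjugation can be undone inside `C_G(Q)KP`.
  have h1 : x * c * x⁻¹ ∈ centralizer (Q : Set G) := by
    rw [mem_centralizer_iff] at hc ⊢
    intro q hq
    have h2 := hc _ (hxQ q hq)
    calc q * (x * c * x⁻¹) = x * (x⁻¹ * q * x * c) * x⁻¹ := by group
      _ = x * c * x⁻¹ * q := by rw [h2]; group
  have hx' : x ∈ centralizer (Q : Set G) ⊔ (K ⊔ P) := mem_sup_right hx
  have := mul_mem (mul_mem (inv_mem hx') (mem_sup_left h1)) hx'
  simpa [mul_assoc] using this

end Subgroup

/-! ### Proof of the theorem -/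

namespace Representation

/-- If the Scott module of a `p`-nilpotent group with respect to a normal `p`-subgroup `P` is
Brauer indecomposable, then the group is covered by `C(P)` and `KP`. -/
lemma IsScottModule.centralizer_sup_eq_top {p : ℕ} [Fact p.Prime] {k G V : Type*} [Field k]
    [CharP k p] [Group G] [Finite G] [AddCommGroup V] [Module k V] {K P : Subgroup G} [K.Normal]
    [P.Normal] (hK : (Nat.card K).Coprime p) (hGK : IsPGroup p (G ⧸ K)) (hP : IsPGroup p P)
    {ρ : Representation k G V} (hρ : IsScottModule P ρ) (hB : IsBrauerIndecomposable p ρ) :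
    Subgroup.centralizer (P : Set G) ⊔ (K ⊔ P) = ⊤ := by
  obtain ⟨b, hb⟩ := hρ.exists_basis p hK hGK
  have hPρ : P ≤ MonoidHom.ker ρ := fun g hg => (apply_eq_one_iff_of_permutes hb g).2
    (QuotientGroup.smul_eq_self_of_mem le_sup_right hg)
  have := hρ.1.1
  -- At `Q = P` the Brauer construction is the whole nonzero module, so its restriction to `PC(P)`
  -- is indecomposable and `PC(P)` is transitive on the cosets of `KP`.
  have h1 := (hB P hP).resolve_right (not_subsingleton_brauer_of_le_ker p hP hPρ)
  rw [isIndecomposable_brauer_comp_iff p hP hPρ] at h1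
  have h2 := h1.sup_eq_top_of_permutes (H := P ⊔ Subgroup.centralizer (P : Set G))
    (by rintro _ ⟨g, rfl⟩; exact g.2) hb
  rw [eq_top_iff, ← h2]
  exact sup_le (sup_le (le_sup_right.trans le_sup_right) le_sup_left) le_sup_right

end Representation

theorem mainTheorem4 {p : ℕ} [Fact p.Prime] {k : Type*} [Field k] [IsAlgClosed k] [CharP k p]
    {G : Type*} [Group G] [Finite G] (hG : IsPNilpotent p G)
    (P : Subgroup G) (hP : IsPGroup p P) (hP1 : P ≠ ⊥)
    {M : Type*} [AddCommGroup M] [Module k M] (ρ : Representation k G M)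
    (hρ : Representation.IsScottModule P ρ) (hker : P ≤ MonoidHom.ker ρ)
    {N : Type*} [AddCommGroup N] [Module k N]
    (σ : Representation k (Subgroup.normalizer (P : Set G)) N)
    (hσ : Representation.IsScottModule (P.subgroupOf (Subgroup.normalizer (P : Set G))) σ)
    (hσB : Representation.IsBrauerIndecomposable p σ) :
    Representation.IsBrauerIndecomposable p ρ := by
  obtain ⟨K, _, hK, hGK⟩ := hG.exists_normal_isPGroup_quotient
  obtain ⟨b, hb⟩ := hρ.exists_basis p hK hGK
  have hKρ : K ≤ MonoidHom.ker ρ := fun g hg => (Representation.apply_eq_one_iff_of_permutes hb g).2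
    (QuotientGroup.smul_eq_self_of_mem le_sup_left hg)
  have hL : K ⊔ P = MonoidHom.ker ρ := Representation.IsScottModule.eq_ker_of_permutes hb hKρ hker
  have hLn : (K ⊔ P).Normal := hL ▸ MonoidHom.normal_ker ρ
  have hGL : IsPGroup p (G ⧸ (K ⊔ P)) := hGK.of_surjective
    (QuotientGroup.map K (K ⊔ P) (MonoidHom.id G) le_sup_left)
    (QuotientGroup.map_surjective_of_surjective _ _ _ QuotientGroup.mk_surjective _)
  have hN : Subgroup.normalizer (P : Set G) ≤ Subgroup.centralizer (P : Set G) ⊔ (K ⊔ P) := by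
    -- `K ∩ N_G(P)` is a normal `p`-complement of `N_G(P)`, so the description of Scott modules
    -- applies to `σ` as well.
    have hK' : (Nat.card (K.subgroupOf (Subgroup.normalizer (P : Set G)))).Coprime p :=
      hK.coprime_dvd_left (Subgroup.card_comap_dvd_of_injective K _ Subtype.val_injective)
    have hGK' : IsPGroup p (Subgroup.normalizer (P : Set G) ⧸
        K.subgroupOf (Subgroup.normalizer (P : Set G))) :=
      isPGroup_iff_pow_pow_eq_one.2 fun x => by
        obtain ⟨g, rfl⟩ := QuotientGroup.mk_surjective x
        obtain ⟨n, hn⟩ := isPGroup_iff_pow_pow_eq_one.1 hGK ((g : G) : G ⧸ K)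
        refine ⟨n, ?_⟩
        rw [← QuotientGroup.mk_pow, QuotientGroup.eq_one_iff] at hn ⊢
        exact hn
    have h1 := Representation.IsScottModule.centralizer_sup_eq_top (P := P.subgroupOf _)
      hK' hGK' hP.comap_subtype hσ hσB
    intro g hg
    have h2 := h1 ▸ Subgroup.mem_top (⟨g, hg⟩ : Subgroup.normalizer (P : Set G))
    refine (sup_le ?_ (sup_le ?_ ?_) : _ ≤ (Subgroup.centralizer (P : Set G) ⊔ (K ⊔ P)).comap
      (Subgroup.normalizer (P : Set G)).subtype) h2
    · intro c hc
      refine Subgroup.mem_sup_left (Subgroup.mem_centralizer_iff.2 fun x hx => ?_)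
      exact congrArg Subtype.val (Subgroup.mem_centralizer_iff.1 hc
        ⟨x, Subgroup.le_normalizer hx⟩ hx)
    · exact fun c hc => Subgroup.mem_sup_right (Subgroup.mem_sup_left hc)
    · exact fun c hc => Subgroup.mem_sup_right (Subgroup.mem_sup_right hc)
  intro Q hQ
  by_cases hQL : Q ≤ K ⊔ P
  · left
    rw [Representation.isIndecomposable_brauer_comp_iff p hQ (hL ▸ hQL)]
    refine Representation.isIndecomposable_comp_of_permutes p hGL (fun c hc => ?_) hb
      (Subgroup.centralizer_sup_eq_top hK hP hN hQ hQL)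
    exact ⟨⟨⟨c, Subgroup.centralizer_le_normalizer _ hc⟩, Subgroup.mem_sup_right hc⟩, rfl⟩
  · exact Or.inr (Representation.subsingleton_brauer_of_permutes hb hQL)
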